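/- Let $k\ge 3$ be an integer and let $G=(V,E)$ be a finite simple $k$-regular graph in which every edge $e\in E$ is equipped with a finite list $L_e$ of available labels. For $n\ge 0$ let $f_n$ denote the number of total preorders on $\{1,\dots,n\}$ (orderings of $n$ elements with possible ties). Put $$R_k:=\left\lceil 2+\frac{k-1}{k-2}\,\bigl(8(k-1)(k-2)f_{k-1}\bigr)^{1/(k-1)}\right\rceil .$$ If $|L_e|\ge R_k$ for every $e\in E$, then there is an edge labeling $\mu$ with $\mu(e)\in L_e$ for every $e\in E$ which distinguishes neighbors by sets, i.e. for any two adjacent vertices $u,v$ the set $\{\mu(e): e\in E,\ u\in e\}$ differs from the set $\{\mu(e): e\in E,\ v\in e\}$ ($\mu$ need not be proper). Moreover, if $k\ge 1540$, then $R_k\le 0.54\,k$. -/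

import Mathlib

noncomputable section

/-- The number of total preorders on a set of `n` elements, i.e. of orderings of
`n` elements with possible ties (the ordered Bell number, or Fubini number).
Reflexivity is the case `a = b` of totality. -/
def totalPreorderCount (n : ℕ) : ℕ :=
  Nat.card {r : Fin n → Fin n → Prop //
    (∀ a b, r a b ∨ r b a) ∧ (∀ a b c, r a b → r b c → r a c)}

/-- The list size
`⌈2 + (k-1)/(k-2) * (8 (k-1) (k-2) f_{k-1})^(1/(k-1))⌉`, meant for `k ≥ 3`,
where `f_n` is the number of total preorders on `n` elements. -/
def edgeSetListSize (k : ℕ) : ℕ :=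
  ⌈(2 : ℝ) + ((k : ℝ) - 1) / ((k : ℝ) - 2) *
    (8 * ((k : ℝ) - 1) * ((k : ℝ) - 2) * (totalPreorderCount (k - 1) : ℝ)) ^
      (1 / ((k : ℝ) - 1))⌉₊

namespace SimpleGraph

variable {V : Type*} {α : Type*} (G : SimpleGraph V)

/-- The set of labels on the edges of `G` incident to the vertex `v`. -/
def incidentLabels (μ : G.edgeSet → α) (v : V) : Set α :=
  μ '' {e : G.edgeSet | v ∈ (e : Sym2 V)}

/-- An (unrestricted, not necessarily proper) edge labeling distinguishes neighbors by
sets if adjacent vertices see different sets of labels on their incident edges. -/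
def DistinguishesNeighborsBySets (μ : G.edgeSet → α) : Prop :=
  ∀ u v : V, G.Adj u v → G.incidentLabels μ u ≠ G.incidentLabels μ v

end SimpleGraph

end

/-!
Call an edge labeling good on a set `H` of edges if it has no conflict (adjacent vertices seeing
equal label sets) between vertices all of whose edges lie in `H`. A counting argument in the style
of Rosenfeld shows that, among all list labelings, the number of those good on `H` shrinks by at
most a factor `β / R` when an edge `e` is added to `H`, where `R` is the list size. A new conflict
is between an end `u` of `e` and a neighbor `v` of `u`, at most `2 * k` pairs. For such a pair,
forget the labels of the `k - 1` edges at `u` other than `uv`. They can be recovered from the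
remaining labels in at most `f` ways, `f` being the number of total preorders of `k - 1` elements:
their set is the known label set of `v`, with or without the label of `uv`, and ordering the
labels turns the choice into a total preorder of the edges
(`finite_and_ncard_insert_range_eq_le`). The forgotten labels are free otherwise, and by induction
forgetting costs at most `(R / β) ^ (k - 1)`, so each pair spoils at most a fraction
`f / β ^ (k - 1)` of the good labelings (`exists_distinguishing_of_growth`). With
`β ^ (k - 1) = 8 * (k - 1) * (k - 2) * f` the list size `edgeSetListSize k` suffices.

For the numerical bound, removing the minimal elements of a preorder bounds `f n` by the
recurrence of the ordered Bell numbers, whence `f n ≤ 0.735 * n! / (log 2) ^ n`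
(`totalPreorderCount_mul_le`). Stirling's formula then gives a list size of about
`k / (e * log 2) = 0.5307 * k` up to logarithmic terms, which `0.54 * k` absorbs from `k = 1540` on
(`log_size_inequality`); the margin there is small, so all constants are nearly sharp.
-/

/-! ### Two counting principles -/

open Finset in
/-- The number of points of a product that satisfy both an event depending only on the
coordinates outside `D` and an event that has few solutions once the coordinates outside `D`
are fixed. -/
theorem card_filter_and_mul_pow_le {ι α : Type*} [Fintype ι] [DecidableEq ι]
    (L : ι → Finset α) {R : ℕ} (hL : ∀ i, (L i).card = R) (D : Finset ι)
    (P B : (ι → α) → Prop) [DecidablePred P] [DecidablePred B] {F : ℕ}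
    (hP : ∀ μ ν : ι → α, (∀ i ∉ D, μ i = ν i) → P μ → P ν)
    (hB : ∀ μ : ι → α, {ν : ι → α | (∀ i ∉ D, ν i = μ i) ∧ B ν}.ncard ≤ F)
    (hfin : ∀ μ : ι → α, {ν : ι → α | (∀ i ∉ D, ν i = μ i) ∧ B ν}.Finite) :
    ((Fintype.piFinset L).filter fun μ => P μ ∧ B μ).card * R ^ D.card ≤
      ((Fintype.piFinset L).filter P).card * F := by
  classical
  refine card_mul_le_card_mul (fun ν μ : ι → α => ∀ i ∉ D, ν i = μ i) ?_ ?_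
  · intro ν hν
    simp only [mem_filter, Fintype.mem_piFinset] at hν
    have hcard : (Fintype.piFinset fun i => if i ∈ D then L i else {ν i}).card = R ^ D.card := by
      rw [Fintype.card_piFinset]
      have : ∀ i, (if i ∈ D then L i else {ν i}).card = if i ∈ D then R else 1 := by
        intro i; split_ifs <;> simp [hL]
      simp [this]
    rw [← hcard]
    refine card_le_card fun μ hμ => ?_
    rw [Fintype.mem_piFinset] at hμ
    have hoff : ∀ i ∉ D, ν i = μ i := fun i hi => by
      have := hμ i
      simp only [hi, if_false, mem_singleton] at this
      exact this.symm
    rw [mem_bipartiteAbove, mem_filter, Fintype.mem_piFinset]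
    refine ⟨⟨fun i => ?_, hP _ _ hoff hν.2.1⟩, hoff⟩
    by_cases hi : i ∈ D
    · simpa [hi] using hμ i
    · rw [← hoff i hi]; exact hν.1 i
  · intro μ _
    refine le_trans ?_ (hB μ)
    rw [← Set.ncard_coe_finset]
    refine Set.ncard_le_ncard (fun ν hν => ?_) (hfin μ)
    simp only [bipartiteBelow, coe_filter, mem_filter, Set.mem_ofPred_eq] at hν
    exact ⟨hν.2, hν.1.2.2⟩

/-- Strong induction for a nonnegative set function `M`. If adding one point to `H` shrinks `M` by
at most the factor `q`, given that adding the points of any `D` to a subset of `H` so as to reach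
`H` shrinks it by at most `q ^ #D`, then the latter holds for all `H`. -/
theorem pow_card_mul_le_of_step {ι : Type*} [DecidableEq ι] (M : Finset ι → ℝ) {q : ℝ}
    (hq0 : 0 ≤ q) (hq1 : q ≤ 1) (hM : ∀ H, 0 ≤ M H)
    (step : ∀ H e, e ∉ H → (∀ D : Finset ι, q ^ D.card * M (H \ D) ≤ M H) →
      q * M H ≤ M (insert e H)) (H : Finset ι) :
    ∀ D : Finset ι, q ^ D.card * M (H \ D) ≤ M H := by
  induction H using Finset.strongInduction with
  | H H ih =>
    intro D
    by_cases hD : Disjoint H D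
    · rw [Finset.sdiff_eq_self_of_disjoint hD]
      exact mul_le_of_le_one_left (hM H) (pow_le_one₀ hq0 hq1)
    · obtain ⟨e, heH, heD⟩ := Finset.not_disjoint_iff.mp hD
      have hlt := Finset.erase_ssubset heH
      have h1 := step (H.erase e) e (Finset.notMem_erase e H) (ih _ hlt)
      rw [Finset.insert_erase heH] at h1
      have h2 := ih _ hlt (D.erase e)
      have h3 : H.erase e \ D.erase e = H \ D := by
        ext x
        simp only [Finset.mem_sdiff, Finset.mem_erase]
        by_cases hx : x = e
        · subst hx; simp [heD]
        · simp [hx]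
      rw [h3] at h2
      have h4 : q ^ D.card = q * q ^ (D.erase e).card := by
        rw [← pow_succ', Finset.card_erase_add_one heD]
      calc q ^ D.card * M (H \ D) = q * (q ^ (D.erase e).card * M (H \ D)) := by
            rw [h4]; ring
        _ ≤ q * M (H.erase e) := mul_le_mul_of_nonneg_left h2 hq0
        _ ≤ M H := h1

/-! ### Total preorders and maps with prescribed range -/

/-- The total preorders on `ι`. -/
abbrev TotalPreorder (ι : Type*) : Type _ :=
  {r : ι → ι → Prop // (∀ a b, r a b ∨ r b a) ∧ (∀ a b c, r a b → r b c → r a c)}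

theorem natCard_totalPreorder (ι : Type*) [Fintype ι] :
    Nat.card (TotalPreorder ι) = totalPreorderCount (Fintype.card ι) := by
  let e := Fintype.equivFin ι
  refine Nat.card_congr (Equiv.subtypeEquiv (e.arrowCongr (e.arrowCongr (Equiv.refl Prop))) ?_)
  intro r
  simp only [Equiv.arrowCongr_apply, Equiv.coe_refl, Function.comp_apply, id]
  refine and_congr ?_ ?_
  · rw [← e.forall_congr_right]
    refine forall_congr' fun a => ?_
    rw [← e.forall_congr_right]
    simp
  · rw [← e.forall_congr_right]
    refine forall_congr' fun a => ?_
    rw [← e.forall_congr_right]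
    refine forall_congr' fun b => ?_
    rw [← e.forall_congr_right]
    simp

instance finite_totalPreorder (ι : Type*) [Finite ι] : Finite (TotalPreorder ι) :=
  Subtype.finite

theorem eq_of_range_eq_of_le_iff {ι α : Type*} [LinearOrder α] [Finite ι] {g h : ι → α}
    (hr : Set.range g = Set.range h) (hgh : ∀ a b, g a ≤ g b ↔ h a ≤ h b) : g = h := by
  by_contra hne
  have hlt : ∀ a b, g a < g b ↔ h a < h b := fun a b => by
    rw [← not_le, ← not_le, hgh]
  have hS : {a | g a ≠ h a}.Nonempty := Function.ne_iff.mp hne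
  obtain ⟨a, ha, hmin⟩ := Set.exists_min_image _ g (Set.toFinite _) hS
  obtain ⟨b, hb⟩ : g a ∈ Set.range h := hr ▸ Set.mem_range_self a
  obtain ⟨d, hd⟩ : h a ∈ Set.range g := hr ▸ Set.mem_range_self a
  have key : ∀ x, g x < g a → g x = h x := fun x hx => by
    by_contra hxa
    exact absurd (hmin x hxa) (not_le.mpr hx)
  rcases lt_trichotomy (h b) (h a) with hba | hba | hba
  · have h1 := (hlt b a).mpr hba
    exact h1.ne ((key b h1).trans hb)
  · exact ha (hb.symm.trans hba)
  · have h1 : g d < g a := by rw [hd, ← hb]; exact hba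
    exact ((hlt d a).mp h1).ne ((key d h1).symm.trans hd)

/-- The maps whose range, enlarged by a fixed point `c`, is a prescribed set inject into the total
preorders of the domain, by pulling back a linear order: the number of classes of the preorder
tells whether `c` lies in the range, and a map with known range is determined by its preorder. -/
theorem finite_and_ncard_insert_range_eq_le {ι α : Type*} [Fintype ι] (c : α) (T : Set α) :
    {g : ι → α | insert c (Set.range g) = T}.Finite ∧
      {g : ι → α | insert c (Set.range g) = T}.ncard ≤
        totalPreorderCount (Fintype.card ι) := by
  classical
  let _ : LinearOrder α := linearOrderOfSTO WellOrderingRel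
  let φ : {g : ι → α | insert c (Set.range g) = T} → TotalPreorder ι := fun g =>
    ⟨fun a b => g.1 a ≤ g.1 b, fun a b => le_total _ _, fun a b c => le_trans⟩
  have hφ : Function.Injective φ := by
    rintro ⟨g, hg⟩ ⟨h, hh⟩ hgh
    have hle : ∀ a b, g a ≤ g b ↔ h a ≤ h b := fun a b =>
      iff_of_eq (congrFun (congrFun (congrArg Subtype.val hgh) a) b)
    have hker : Setoid.ker g = Setoid.ker h := by
      ext a b
      simp only [Setoid.ker_def, le_antisymm_iff, hle]
    have hcard : (Set.range g).ncard = (Set.range h).ncard := by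
      have e1 := Nat.card_congr (Setoid.quotientKerEquivRange g)
      have e2 := Nat.card_congr (Setoid.quotientKerEquivRange h)
      rw [hker] at e1
      exact e1.symm.trans e2
    have hT : insert c (Set.range g) = insert c (Set.range h) := Eq.trans hg (Eq.symm hh)
    have hrange : Set.range g = Set.range h := by
      by_cases hcg : c ∈ Set.range g
      · rw [Set.insert_eq_of_mem hcg] at hT
        exact (Set.eq_of_subset_of_ncard_le (hT ▸ Set.subset_insert c _) hcard.le
          (Set.finite_range g)).symm
      · by_cases hch : c ∈ Set.range h
        · rw [Set.insert_eq_of_mem hch] at hT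
          exact Set.eq_of_subset_of_ncard_le (hT ▸ Set.subset_insert c _) hcard.ge
            (Set.finite_range h)
        · have := congrArg (fun s => s \ {c}) hT
          simpa [Set.insert_sdiff_of_mem, hcg, hch] using this
    exact Subtype.ext (eq_of_range_eq_of_le_iff hrange hle)
  refine ⟨Finite.of_injective φ hφ, ?_⟩
  rw [← natCard_totalPreorder]
  exact Nat.card_le_card_of_injective φ hφ

/-! ### Counting good labelings of a graph -/

namespace SimpleGraph

open Finset

variable {V : Type*} [Fintype V] {α : Type*} (G : SimpleGraph V)

open Classical in
/-- The edges of `G` at the vertex `v`. -/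
noncomputable def star (v : V) : Finset G.edgeSet := univ.filter fun e => v ∈ (e : Sym2 V)

variable {G}

@[simp]
theorem mem_star {v : V} {e : G.edgeSet} : e ∈ G.star v ↔ v ∈ (e : Sym2 V) := by
  simp [star]

theorem card_star [DecidableRel G.Adj] (v : V) : (G.star v).card = G.degree v := by
  classical
  rw [← card_incidenceFinset_eq_degree, ← card_map (Function.Embedding.subtype _)]
  congr 1
  ext e
  simp [incidenceSet, and_comm]

theorem incidentLabels_eq (μ : G.edgeSet → α) (v : V) :
    G.incidentLabels μ v = μ '' (G.star v : Set G.edgeSet) := by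
  rw [incidentLabels]
  congr 1
  ext e
  simp

/-- `μ` has no conflict visible inside the edge set `H`: two adjacent vertices all of whose edges
lie in `H` see different sets of labels. -/
def GoodOn (H : Finset G.edgeSet) (μ : G.edgeSet → α) : Prop :=
  ∀ u v, G.Adj u v → G.star u ⊆ H → G.star v ⊆ H → G.incidentLabels μ u ≠ G.incidentLabels μ v

theorem incidentLabels_congr {μ ν : G.edgeSet → α} {v : V} (h : ∀ e ∈ G.star v, μ e = ν e) :
    G.incidentLabels μ v = G.incidentLabels ν v := by
  rw [incidentLabels_eq, incidentLabels_eq]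
  exact Set.image_congr h

theorem GoodOn.congr {H : Finset G.edgeSet} {μ ν : G.edgeSet → α} (h : ∀ e ∈ H, μ e = ν e)
    (hμ : GoodOn H μ) : GoodOn H ν := fun u v huv hu hv => by
  rw [← incidentLabels_congr fun e he => h e (hu he), ← incidentLabels_congr fun e he => h e (hv he)]
  exact hμ u v huv hu hv

theorem GoodOn.mono {H K : Finset G.edgeSet} {μ : G.edgeSet → α} (h : K ⊆ H)
    (hμ : GoodOn H μ) : GoodOn K μ :=
  fun u v huv hu hv => hμ u v huv (hu.trans h) (hv.trans h)

/-- Two vertices of a simple graph share at most the edge that joins them. -/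
theorem eq_of_mem_star_of_mem_star {u v : V} (h : G.Adj u v) {e : G.edgeSet} (hu : e ∈ G.star u)
    (hv : e ∈ G.star v) : e = ⟨s(u, v), h⟩ :=
  Subtype.ext ((Sym2.mem_and_mem_iff h.ne).mp ⟨mem_star.mp hu, mem_star.mp hv⟩)

/-- Once the labels off the edges at `u` other than `uv` are fixed, few choices of the remaining
labels make `u` and `v` see the same set. -/
theorem finite_and_ncard_conflict_le [DecidableEq G.edgeSet] {u v : V} (h : G.Adj u v)
    (μ : G.edgeSet → α) :
    {ν : G.edgeSet → α | (∀ e ∉ (G.star u).erase ⟨s(u, v), h⟩, ν e = μ e) ∧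
        G.incidentLabels ν u = G.incidentLabels ν v}.Finite ∧
    {ν : G.edgeSet → α | (∀ e ∉ (G.star u).erase ⟨s(u, v), h⟩, ν e = μ e) ∧
        G.incidentLabels ν u = G.incidentLabels ν v}.ncard ≤
      totalPreorderCount ((G.star u).card - 1) := by
  set f : G.edgeSet := ⟨s(u, v), h⟩ with hf
  have hfu : f ∈ G.star u := by simp [hf]
  set D := (G.star u).erase f with hD
  obtain ⟨hfin, hcard⟩ := finite_and_ncard_insert_range_eq_le (ι := D) (μ f)
    (G.incidentLabels μ v)
  have hDc : Fintype.card D = (G.star u).card - 1 := by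
    rw [Fintype.card_coe, hD, card_erase_of_mem hfu]
  rw [hDc] at hcard
  have hmaps : Set.MapsTo (fun (ν : G.edgeSet → α) (e : D) => ν e)
      {ν : G.edgeSet → α | (∀ e ∉ D, ν e = μ e) ∧
        G.incidentLabels ν u = G.incidentLabels ν v}
      {g : D → α | insert (μ f) (Set.range g) = G.incidentLabels μ v} := by
    rintro ν ⟨hν, huv⟩
    have h1 : G.incidentLabels ν v = G.incidentLabels μ v := by
      refine incidentLabels_congr fun e he => hν e fun heD => ?_
      exact (mem_erase.mp heD).1 (eq_of_mem_star_of_mem_star h (mem_erase.mp heD).2 he)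
    have h2 : Set.range (fun e : D => ν e) = ν '' (D : Set G.edgeSet) := by
      ext x; simp
    show insert (μ f) (Set.range fun e : D => ν e) = _
    rw [← h1, ← huv, h2, ← hν f (notMem_erase _ _), ← Set.image_insert_eq, ← coe_insert,
      insert_erase hfu, incidentLabels_eq]
  have hinj : Set.InjOn (fun (ν : G.edgeSet → α) (e : D) => ν e)
      {ν : G.edgeSet → α | (∀ e ∉ D, ν e = μ e) ∧
        G.incidentLabels ν u = G.incidentLabels ν v} := by
    rintro ν ⟨hν, -⟩ ν' ⟨hν', -⟩ hνν
    funext e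
    by_cases he : e ∈ D
    · exact congrFun hνν ⟨e, he⟩
    · rw [hν e he, hν' e he]
  exact ⟨Set.Finite.of_finite_image (hfin.subset hmaps.image_subset) hinj,
    (Set.ncard_le_ncard_of_injOn _ hmaps hinj hfin).trans hcard⟩

/-- Every new conflict that appears when the edge `e` is added to `H` is between an end of `e` and
one of its neighbors. -/
theorem exists_conflict_of_not_goodOn_insert [DecidableEq G.edgeSet] {H : Finset G.edgeSet}
    {e : G.edgeSet} {μ : G.edgeSet → α} (hμ : GoodOn H μ) (h : ¬ GoodOn (insert e H) μ) :
    ∃ u v, u ∈ (e : Sym2 V) ∧ G.Adj u v ∧ G.incidentLabels μ u = G.incidentLabels μ v := by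
  simp only [GoodOn, not_forall, not_not] at h
  obtain ⟨u, v, huv, hu, hv, heq⟩ := h
  by_cases heu : e ∈ G.star u
  · exact ⟨u, v, mem_star.mp heu, huv, heq⟩
  by_cases hev : e ∈ G.star v
  · exact ⟨v, u, mem_star.mp hev, huv.symm, heq.symm⟩
  exact absurd heq (hμ u v huv ((subset_insert_iff_of_notMem heu).mp hu)
    ((subset_insert_iff_of_notMem hev).mp hv))

/-- List labelings distinguishing neighbors exist once lists of size `R` leave room for a growth
factor `β` per added edge. Below, `2 * k` bounds the number of conflicts that one edge can create,
and `β ^ (k - 1)` is gained by forgetting the labels of `k - 1` edges. -/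
theorem exists_distinguishing_of_growth [DecidableRel G.Adj] {k R : ℕ} (hk : 1 ≤ k)
    (hG : G.IsRegularOfDegree k) (L : G.edgeSet → Finset α) (hL : ∀ e, (L e).card = R)
    {β : ℝ} (hβ : 0 < β) (hβR : β ≤ R)
    (hgrow : β + 2 * k * (totalPreorderCount (k - 1) / β ^ (k - 1)) * R ≤ R) :
    ∃ μ : G.edgeSet → α, (∀ e, μ e ∈ L e) ∧ G.DistinguishesNeighborsBySets μ := by
  classical
  have hR : (0 : ℝ) < R := hβ.trans_le hβR
  set F := totalPreorderCount (k - 1) with hF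
  let N : Finset G.edgeSet → ℕ := fun H => ((Fintype.piFinset L).filter (GoodOn H)).card
  have hstar : ∀ v, (G.star v).card = k := fun v => (card_star v).trans (hG v)
  have hbad : ∀ (H : Finset G.edgeSet) (u v : V), G.Adj u v →
      (∀ D : Finset G.edgeSet, (β / R) ^ D.card * N (H \ D) ≤ N H) →
      (((Fintype.piFinset L).filter fun μ => GoodOn H μ ∧
        G.incidentLabels μ u = G.incidentLabels μ v).card : ℝ) ≤ F / β ^ (k - 1) * N H := by
    intro H u v huv hH
    set D := (G.star u).erase ⟨s(u, v), huv⟩ with hD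
    have hDk : D.card = k - 1 := by
      rw [hD, card_erase_of_mem (by simp), hstar]
    have hcount := card_filter_and_mul_pow_le L hL D (GoodOn (H \ D))
      (fun μ => G.incidentLabels μ u = G.incidentLabels μ v) (F := F)
      (fun μ ν hμν => GoodOn.congr fun e he => hμν e (mem_sdiff.mp he).2)
      (fun μ => by
        have := (finite_and_ncard_conflict_le huv μ).2
        rwa [hstar] at this)
      (fun μ => (finite_and_ncard_conflict_le huv μ).1)
    have hle : ((Fintype.piFinset L).filter fun μ => GoodOn H μ ∧
        G.incidentLabels μ u = G.incidentLabels μ v).card ≤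
        ((Fintype.piFinset L).filter fun μ => GoodOn (H \ D) μ ∧
        G.incidentLabels μ u = G.incidentLabels μ v).card :=
      card_le_card (monotone_filter_right _ fun μ _ h => ⟨h.1.mono sdiff_subset, h.2⟩)
    have hHD := hH D
    rw [hDk] at hHD hcount
    have h1 : (((Fintype.piFinset L).filter fun μ => GoodOn H μ ∧
        G.incidentLabels μ u = G.incidentLabels μ v).card : ℝ) * R ^ (k - 1) ≤ N (H \ D) * F := by
      refine le_trans (mul_le_mul_of_nonneg_right (Nat.cast_le.mpr hle) (by positivity)) ?_
      exact_mod_cast hcount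
    have hβk : 0 < β ^ (k - 1) := by positivity
    have hRk : (0 : ℝ) < (R : ℝ) ^ (k - 1) := by positivity
    rw [div_pow, div_mul_eq_mul_div, div_le_iff₀ hRk] at hHD
    rw [div_mul_eq_mul_div, le_div_iff₀ hβk]
    refine le_of_mul_le_mul_right ?_ hRk
    calc _ = (((Fintype.piFinset L).filter fun μ => GoodOn H μ ∧
        G.incidentLabels μ u = G.incidentLabels μ v).card : ℝ) * R ^ (k - 1) * β ^ (k - 1) := by
          ring
      _ ≤ N (H \ D) * F * β ^ (k - 1) := mul_le_mul_of_nonneg_right h1 hβk.le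
      _ = F * (β ^ (k - 1) * N (H \ D)) := by ring
      _ ≤ F * (N H * R ^ (k - 1)) := mul_le_mul_of_nonneg_left hHD (Nat.cast_nonneg _)
      _ = _ := by ring
  have hstep : ∀ H e, e ∉ H →
      (∀ D : Finset G.edgeSet, (β / R) ^ D.card * N (H \ D) ≤ N H) →
      β / R * N H ≤ N (insert e H) := by
    intro H e _ hH
    have hsub : (Fintype.piFinset L).filter (GoodOn H) ⊆
        (Fintype.piFinset L).filter (GoodOn (insert e H)) ∪
          (e : Sym2 V).toFinset.biUnion fun u => (G.neighborFinset u).biUnion fun v =>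
            (Fintype.piFinset L).filter fun μ => GoodOn H μ ∧
              G.incidentLabels μ u = G.incidentLabels μ v := by
      intro μ hμ
      rw [mem_filter] at hμ
      by_cases hg : GoodOn (insert e H) μ
      · exact mem_union_left _ (mem_filter.mpr ⟨hμ.1, hg⟩)
      · obtain ⟨u, v, hu, huv, heq⟩ := exists_conflict_of_not_goodOn_insert hμ.2 hg
        refine mem_union_right _ (mem_biUnion.mpr ⟨u, Sym2.mem_toFinset.mpr hu,
          mem_biUnion.mpr ⟨v, (mem_neighborFinset _ _ _).mpr huv, mem_filter.mpr ⟨hμ.1, hμ.2, heq⟩⟩⟩)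
    have h1 := (card_le_card hsub).trans ((card_union_le _ _).trans
      (Nat.add_le_add_left (card_biUnion_le.trans (sum_le_sum fun u _ => card_biUnion_le)) _))
    have h2 : (N H : ℝ) ≤ N (insert e H) + ∑ u ∈ (e : Sym2 V).toFinset, ∑ v ∈ G.neighborFinset u,
        (((Fintype.piFinset L).filter fun μ => GoodOn H μ ∧
          G.incidentLabels μ u = G.incidentLabels μ v).card : ℝ) := by
      exact_mod_cast h1
    have h3 : ∑ u ∈ (e : Sym2 V).toFinset, ∑ v ∈ G.neighborFinset u,
        (((Fintype.piFinset L).filter fun μ => GoodOn H μ ∧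
          G.incidentLabels μ u = G.incidentLabels μ v).card : ℝ) ≤
        ∑ u ∈ (e : Sym2 V).toFinset, ∑ v ∈ G.neighborFinset u, F / β ^ (k - 1) * N H :=
      sum_le_sum fun u _ => sum_le_sum fun v hv =>
        hbad H u v ((mem_neighborFinset _ _ _).mp hv) hH
    have h4 : (e : Sym2 V).toFinset.card = 2 :=
      Sym2.card_toFinset_of_not_isDiag _ (G.not_isDiag_of_mem_edgeSet e.2)
    have hdeg : ∀ u, (G.neighborFinset u).card = k := fun u => hG u
    simp only [sum_const, hdeg, h4, nsmul_eq_mul] at h3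
    rw [div_mul_eq_mul_div, div_le_iff₀ hR]
    have h5 := mul_le_mul_of_nonneg_right hgrow (Nat.cast_nonneg (α := ℝ) (N H))
    have h6 := mul_le_mul_of_nonneg_right (h2.trans (add_le_add_right h3 _)) hR.le
    push_cast at h6
    linarith
  have hmain := pow_card_mul_le_of_step (fun H => (N H : ℝ)) (q := β / R) (by positivity)
    ((div_le_one hR).mpr hβR) (fun _ => Nat.cast_nonneg _) hstep univ univ
  have hempty : 0 < N ∅ := by
    refine card_pos.mpr ?_
    have hne : (Fintype.piFinset L).Nonempty := Fintype.piFinset_nonempty.mpr fun e =>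
      card_pos.mp (by rw [hL]; exact_mod_cast hR)
    obtain ⟨μ, hμ⟩ := hne
    refine ⟨μ, mem_filter.mpr ⟨hμ, fun u v _ hu _ => ?_⟩⟩
    have := hstar u
    rw [subset_empty.mp hu, card_empty] at this
    omega
  have hpos : (0 : ℝ) < N univ := by
    refine lt_of_lt_of_le ?_ hmain
    have : (0 : ℝ) < N ∅ := by exact_mod_cast hempty
    simp only [sdiff_self]
    positivity
  obtain ⟨μ, hμ⟩ := card_pos.mp (Nat.cast_pos.mp hpos)
  rw [mem_filter, Fintype.mem_piFinset] at hμ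
  exact ⟨μ, hμ.1, fun u v huv => hμ.2 u v huv (subset_univ _) (subset_univ _)⟩

end SimpleGraph

/-! ### An upper bound for the number of total preorders -/

section

open Finset Real
open scoped Nat

/-- Splitting off the nonempty set of minimal elements embeds the total preorders of a nonempty
set into the pairs of a nonempty subset and a total preorder of its complement; `j` is the size
of the complement. -/
theorem totalPreorderCount_le_sum {n : ℕ} (hn : n ≠ 0) :
    totalPreorderCount n ≤ ∑ j ∈ range n, n.choose j * totalPreorderCount j := by
  classical
  let A := {t : Finset (Fin n) // t ≠ univ}
  let ψ : TotalPreorder (Fin n) → Σ t : A, TotalPreorder t.1 := fun r =>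
    ⟨⟨univ.filter fun a => ¬ ∀ b, r.1 a b, by
        have : NeZero n := ⟨hn⟩
        have hdir : Directed (fun a b => r.1 b a) (id : Fin n → Fin n) := fun a b => by
          rcases r.2.1 a b with h | h
          · exact ⟨a, (r.2.1 a a).elim id id, h⟩
          · exact ⟨b, h, (r.2.1 b b).elim id id⟩
        have : IsTrans (Fin n) (fun a b => r.1 b a) := ⟨fun a b c h1 h2 => r.2.2 _ _ _ h2 h1⟩
        obtain ⟨z, hz⟩ := hdir.finite_le (id : Fin n → Fin n)
        intro h
        have := h ▸ mem_univ z
        rw [mem_filter] at this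
        exact this.2 hz⟩,
      ⟨fun a b => r.1 a b, fun a b => r.2.1 a b, fun a b c => r.2.2 a b c⟩⟩
  have hψ : Function.Injective ψ := by
    intro r r' h
    have h1 : ∀ a, (∀ b, r.1 a b) ↔ ∀ b, r'.1 a b := by
      intro a
      have : a ∈ (ψ r).1.1 ↔ a ∈ (ψ r').1.1 := by rw [h]
      simp only [ψ, mem_filter, mem_univ, true_and] at this
      exact not_iff_not.mp this
    have h2 : ∀ (x y : Σ t : A, TotalPreorder t.1), x = y → ∀ a b (ha : a ∈ x.1.1)
        (hb : b ∈ x.1.1) (ha' : a ∈ y.1.1) (hb' : b ∈ y.1.1),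
        x.2.1 ⟨a, ha⟩ ⟨b, hb⟩ ↔ y.2.1 ⟨a, ha'⟩ ⟨b, hb'⟩ := by
      rintro x _ rfl a b _ _ _ _; rfl
    refine Subtype.ext (funext fun a => funext fun b => propext ?_)
    by_cases ha : ∀ c, r.1 a c
    · exact iff_of_true (ha b) ((h1 a).mp ha b)
    · by_cases hb : ∀ c, r.1 b c
      · exact iff_of_false (fun hab => ha fun c => r.2.2 _ _ _ hab (hb c))
          fun hab => ha ((h1 a).mpr fun c => r'.2.2 _ _ _ hab ((h1 b).mp hb c))
      · exact h2 _ _ h a b (by simpa [ψ] using ha) (by simpa [ψ] using hb)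
          (by simpa [ψ, h1] using ha) (by simpa [ψ, h1] using hb)
  have hcard : totalPreorderCount n ≤ ∑ t : A, totalPreorderCount t.1.card := by
    have h1 := Nat.card_le_card_of_injective ψ hψ
    rw [natCard_totalPreorder, Fintype.card_fin, Nat.card_sigma] at h1
    simpa only [natCard_totalPreorder, Fintype.card_coe] using h1
  refine hcard.trans (le_of_eq ?_)
  have h3 : ∑ t : A, totalPreorderCount t.1.card =
      ∑ t ∈ (univ : Finset (Finset (Fin n))).erase univ, totalPreorderCount t.card :=
    (sum_subtype _ (fun t => by simp) fun t : Finset (Fin n) => totalPreorderCount t.card).symm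
  have h4 := sum_powerset_apply_card totalPreorderCount (x := (univ : Finset (Fin n)))
  rw [powerset_univ, card_fin, sum_range_succ, ← add_sum_erase _ _ (mem_univ univ)] at h4
  simp only [card_fin, smul_eq_mul, Nat.choose_self, one_mul] at h4
  rw [h3]
  omega

theorem totalPreorderCount_pos (n : ℕ) : 0 < totalPreorderCount n :=
  Nat.card_pos_iff.mpr ⟨⟨⟨fun _ _ => True, by simp⟩⟩, finite_totalPreorder (Fin n)⟩

theorem totalPreorderCount_zero : totalPreorderCount 0 = 1 := by
  refine Nat.card_eq_one_iff_unique.mpr ⟨⟨fun r s => ?_⟩, ⟨⟨fun _ _ => True, by simp⟩⟩⟩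
  exact Subtype.ext (funext fun a => a.elim0)

/-- The total preorders of `n ≥ 1` elements number less than `0.735 * n! / (log 2) ^ n`; the
asymptotic constant is `1 / (2 * log 2) = 0.721...`. The second term makes the induction along
`totalPreorderCount_le_sum` work: with `w j = (log 2) ^ j / j!`, the `w j` sum to `2` and
`∑ w i * w (n - i) = 2 ^ n * w n`. -/
theorem totalPreorderCount_mul_le {n : ℕ} (hn : n ≠ 0) :
    totalPreorderCount n * (log 2 ^ n / n !) ≤ 0.735 - 0.053 * (log 2 ^ n / n !) := by
  set w : ℕ → ℝ := fun j => log 2 ^ j / j ! with hw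
  have hlog := log_two_gt_d9
  have hlog' := log_two_lt_d9
  have hw0 : ∀ j, 0 < w j := fun j => by
    have : 0 < log 2 := log_pos one_lt_two
    positivity
  have hrec : ∀ m : ℕ, m ≠ 0 →
      totalPreorderCount m * w m ≤ ∑ j ∈ range m, w (m - j) * (totalPreorderCount j * w j) := by
    intro m hm
    have h1 : (totalPreorderCount m : ℝ) ≤ ∑ j ∈ range m, (m.choose j : ℝ) * totalPreorderCount j := by
      exact_mod_cast totalPreorderCount_le_sum hm
    refine (mul_le_mul_of_nonneg_right h1 (hw0 m).le).trans (le_of_eq ?_)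
    rw [sum_mul]
    refine sum_congr rfl fun j hj => ?_
    have hjm : j ≤ m := (mem_range.mp hj).le
    have h2 : (m.choose j : ℝ) * w m = w (m - j) * w j := by
      simp only [hw]
      rw [Nat.cast_choose ℝ hjm]
      have h3 : log 2 ^ m = log 2 ^ (m - j) * log 2 ^ j := by rw [← pow_add, Nat.sub_add_cancel hjm]
      rw [h3]
      field_simp
    calc _ = (m.choose j : ℝ) * w m * totalPreorderCount j := by ring
      _ = _ := by rw [h2]; ring
  have hexp : ∀ m : ℕ, ∑ j ∈ range m, w j ≤ 2 := fun m => by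
    have := sum_le_exp_of_nonneg (log_pos one_lt_two).le m
    rwa [exp_log two_pos] at this
  have hconv : ∀ m : ℕ, ∑ j ∈ range (m + 1), w (m - j) * w j = 2 ^ m * w m := by
    intro m
    have h1 : ∑ j ∈ range (m + 1), (m.choose j : ℝ) = 2 ^ m := by
      exact_mod_cast Nat.sum_range_choose m
    rw [← h1, sum_mul]
    refine sum_congr rfl fun j hj => ?_
    have hjm : j ≤ m := Nat.lt_succ_iff.mp (mem_range.mp hj)
    simp only [hw]
    rw [Nat.cast_choose ℝ hjm]
    have h3 : log 2 ^ m = log 2 ^ (m - j) * log 2 ^ j := by rw [← pow_add, Nat.sub_add_cancel hjm]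
    rw [h3]
    field_simp
  change totalPreorderCount n * w n ≤ 0.735 - 0.053 * w n
  induction n using Nat.strong_induction_on with
  | _ n ih =>
    have hw_zero : w 0 = 1 := by simp [hw]
    have hw_one : w 1 = log 2 := by simp [hw]
    have hw_two : w 2 = log 2 ^ 2 / 2 := by simp [hw]
    have hr1 := hrec 1 one_ne_zero
    simp only [sum_range_one, totalPreorderCount_zero, hw_zero, hw_one, Nat.sub_zero,
      Nat.cast_one, mul_one] at hr1
    rcases (show n = 1 ∨ n = 2 ∨ 3 ≤ n by omega) with rfl | rfl | hn3
    · rw [hw_one]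
      linarith
    · have hr2 := hrec 2 two_ne_zero
      simp only [sum_range_succ, sum_range_zero, totalPreorderCount_zero, hw_zero, hw_one, hw_two,
        Nat.sub_zero, Nat.cast_one, mul_one, zero_add, Nat.add_one_sub_one] at hr2
      rw [hw_two]
      nlinarith
    · obtain ⟨m, rfl⟩ : ∃ m, n = m + 1 := ⟨n - 1, by omega⟩
      set n := m + 1 with hnm
      have hr := hrec n hn
      rw [hnm, sum_range_succ', ← hnm] at hr
      have hsum : ∑ j ∈ range m, w (n - (j + 1)) *
          (totalPreorderCount (j + 1) * w (j + 1)) ≤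
          ∑ j ∈ range m, w (n - (j + 1)) * (0.735 - 0.053 * w (j + 1)) :=
        sum_le_sum fun j hj => mul_le_mul_of_nonneg_left
          (ih (j + 1) (by have := mem_range.mp hj; omega) (Nat.succ_ne_zero j)) (hw0 _).le
      have hsplit : ∑ j ∈ range m, w (n - (j + 1)) * (0.735 - 0.053 * w (j + 1)) =
          0.735 * ∑ j ∈ range m, w (n - (j + 1)) -
            0.053 * ∑ j ∈ range m, w (n - (j + 1)) * w (j + 1) := by
        rw [mul_sum, mul_sum, ← sum_sub_distrib]
        exact sum_congr rfl fun j _ => by ring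
      have hc := hconv n
      rw [sum_range_succ, hnm, sum_range_succ', ← hnm] at hc
      have he := hexp (n + 1)
      rw [sum_range_succ, hnm, sum_range_succ', ← hnm] at he
      have hrefl : ∑ j ∈ range m, w (n - (j + 1)) = ∑ j ∈ range m, w (j + 1) := by
        rw [← sum_range_reflect]
        refine sum_congr rfl fun j hj => ?_
        have := mem_range.mp hj
        congr 1
        omega
      rw [hrefl] at hsplit
      simp only [hw_zero, totalPreorderCount_zero, Nat.sub_zero, Nat.sub_self, Nat.cast_one,
        mul_one, one_mul] at hc he hr
      have hpow : (8 : ℝ) ≤ 2 ^ n := by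
        calc (8 : ℝ) = 2 ^ 3 := by norm_num
          _ ≤ 2 ^ n := pow_le_pow_right₀ one_le_two hn3
      have := mul_le_mul_of_nonneg_right hpow (hw0 n).le
      linarith

end

/-! ### Estimates of the list size -/

section

open Real
open scoped Nat

/-- Stirling's upper bound, with the constant `stirlingSeq 10` in place of its limit `√π`. -/
theorem log_factorial_le {n : ℕ} (hn : 10 ≤ n) :
    log n ! ≤ log (Stirling.stirlingSeq 10) + 1 / 2 * log (2 * n) + n * (log n - 1) := by
  have h1 := Stirling.log_stirlingSeq_formula n
  have h2 := Stirling.log_stirlingSeq'_antitone (show 9 ≤ n - 1 by omega)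
  simp only [Function.comp_apply, Nat.succ_eq_add_one, Nat.sub_add_cancel (show 1 ≤ n by omega)]
    at h2
  have hn0 : (n : ℝ) ≠ 0 := by positivity
  rw [log_div hn0 (exp_ne_zero _), log_exp] at h1
  norm_num at h1 h2 ⊢
  linarith

theorem log_stirlingSeq_ten_le :
    log 8 + log 0.735 + log (Stirling.stirlingSeq 10) + 1 / 2 * log 2 ≤ 2.7 := by
  have h1 := Stirling.log_stirlingSeq_formula 10
  have hf : ((10 ! : ℕ) : ℝ) = 3628800 := by norm_num [Nat.factorial]
  push_cast at h1
  rw [hf, log_div (by norm_num) (exp_ne_zero _), log_exp, log_mul two_ne_zero (by norm_num)] at h1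
  -- Raising to the tenth power clears the denominators of the logarithmic inequality.
  have h2 : log ((8 * 0.735 * 3628800) ^ 10 * 2.7182818286 ^ 73) ≤ log (10 ^ 105) :=
    log_le_log (by norm_num) (by norm_num)
  rw [log_mul (by norm_num) (by norm_num), log_pow, log_pow, log_pow,
    log_mul (by norm_num) (by norm_num), log_mul (by norm_num) (by norm_num)] at h2
  have h3 : 1 ≤ log 2.7182818286 := by
    rw [le_log_iff_exp_le (by norm_num)]
    exact exp_one_lt_d9.le
  push_cast at h2
  linarith

theorem log_1539_le : log 1539 ≤ 7.3393 := by
  -- `180 / 17` is slightly more than `log 1539 / log 2 = 10.5878...`.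
  have h1 : log (1539 ^ 17) ≤ log (2 ^ 180) := log_le_log (by norm_num) (by norm_num)
  rw [log_pow, log_pow] at h1
  push_cast at h1
  linarith [log_two_lt_d9]

/-- The number `0.54` exceeds `1 / (e * log 2) = 0.5307...`, the limit of
`f ^ (1 / n) / n` for `f` the number of total preorders of `n` elements. -/
theorem le_log_add_one_add_log_log_two : 0.0173 ≤ log 0.54 + 1 + log (log 2) := by
  have h1 := log_two_gt_d9
  have h2 := exp_one_gt_d9
  have h3 : exp 0.0173 ≤ 0.54 * exp 1 * log 2 := by
    have h4 := exp_bound' (x := 0.0173) (by norm_num) (by norm_num) (n := 4) (by norm_num)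
    norm_num [Finset.sum_range_succ, Nat.factorial] at h4 ⊢
    nlinarith
  rw [← le_log_iff_exp_le (by positivity), log_mul (by positivity) (by positivity),
    log_mul (by norm_num) (exp_ne_zero _), log_exp] at h3
  exact h3

/-- The logarithmic form of the bound on the list size. At `n = 1539` the two sides differ by
less than `0.1`. -/
theorem log_size_inequality {n : ℝ} (hn : 1539 ≤ n) :
    2.7 + 2.5 * log n + (n - 1) * (log n - log (n - 1)) ≤
      n * (log 0.54 + 1 + log (log 2)) + n * (log (0.54 * n - 2.44) - log (0.54 * n)) := by
  have hn0 : 0 < n := by linarith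
  have hn1 : 0 < n - 1 := by linarith
  have h54 : 0 < 0.54 * n - 2.44 := by linarith
  have h1 : (n - 1) * (log n - log (n - 1)) ≤ 1 := by
    rw [← log_div hn0.ne' hn1.ne']
    have := log_le_sub_one_of_pos (div_pos hn0 hn1)
    calc _ ≤ (n - 1) * (n / (n - 1) - 1) := mul_le_mul_of_nonneg_left this hn1.le
      _ = 1 := by field_simp; ring
  have h2 : -4.533 ≤ n * (log (0.54 * n - 2.44) - log (0.54 * n)) := by
    rw [← log_div h54.ne' (by positivity)]
    have := one_sub_inv_le_log_of_pos (div_pos h54 (show 0 < 0.54 * n by positivity))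
    refine le_trans ?_ (mul_le_mul_of_nonneg_left this hn0.le)
    rw [inv_div, one_sub_div h54.ne', mul_div_assoc', le_div_iff₀ h54]
    linarith
  have h3 : log n ≤ 7.3393 + (n / 1539 - 1) := by
    have := log_le_sub_one_of_pos (show 0 < n / 1539 by positivity)
    rw [log_div hn0.ne' (by norm_num)] at this
    linarith [log_1539_le]
  have h4 := mul_le_mul_of_nonneg_left le_log_add_one_add_log_log_two hn0.le
  linarith

theorem size_le_of_le {n : ℕ} (hn : 1539 ≤ n) :
    (n : ℝ) / (n - 1) * (8 * n * (n - 1) * totalPreorderCount n) ^ (1 / (n : ℝ)) ≤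
      0.54 * n - 2.44 := by
  have hnR : (1539 : ℝ) ≤ n := by exact_mod_cast hn
  set f : ℝ := (totalPreorderCount n : ℝ) with hf
  set x : ℝ := (n : ℝ) with hx
  have hf0 : 0 < f := Nat.cast_pos.mpr (totalPreorderCount_pos n)
  have hx0 : 0 < x := by linarith
  have hx1 : 0 < x - 1 := by linarith
  have h54 : 0 < 0.54 * x - 2.44 := by linarith
  have hlog2 : 0 < log 2 := log_pos one_lt_two
  have hfact : (0 : ℝ) < n ! := by positivity
  have hlogf : log f ≤ log 0.735 + log n ! - x * log (log 2) := by
    have h1 := totalPreorderCount_mul_le (show n ≠ 0 by omega)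
    have h2 : 0 < log 2 ^ n / (n ! : ℝ) := by positivity
    have h3 : f * (log 2 ^ n / n !) ≤ 0.735 := by linarith
    have h4 := log_le_log (by positivity) h3
    rw [log_mul hf0.ne' h2.ne', log_div (by positivity) hfact.ne', log_pow] at h4
    linarith
  have hst := log_factorial_le (show 10 ≤ n by omega)
  rw [← hx, log_mul two_ne_zero hx0.ne'] at hst
  have hc := log_stirlingSeq_ten_le
  have hX : 0 < 8 * x * (x - 1) * f := by positivity
  have hlogX : log (8 * x * (x - 1) * f) = log 8 + log x + log (x - 1) + log f := by
    rw [log_mul (by positivity) hf0.ne', log_mul (by positivity) hx1.ne',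
      log_mul (by norm_num) hx0.ne']
  have hineq := log_size_inequality hnR
  rw [log_mul (x := 0.54) (by norm_num) hx0.ne'] at hineq
  have key : log (8 * x * (x - 1) * f) * (1 / x) ≤
      log ((0.54 * x - 2.44) * ((x - 1) / x)) := by
    rw [mul_one_div, div_le_iff₀ hx0, hlogX, log_mul h54.ne' (by positivity),
      log_div hx1.ne' hx0.ne']
    linarith
  rw [rpow_def_of_pos hX]
  rw [le_log_iff_exp_le (by positivity)] at key
  calc _ ≤ x / (x - 1) * ((0.54 * x - 2.44) * ((x - 1) / x)) :=
        mul_le_mul_of_nonneg_left key (by positivity)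
    _ = _ := by field_simp

theorem edgeSetListSize_le {k : ℕ} (hk : 1540 ≤ k) : (edgeSetListSize k : ℝ) ≤ 0.54 * k := by
  obtain ⟨n, rfl⟩ : ∃ n, k = n + 1 := ⟨k - 1, by omega⟩
  have h := size_le_of_le (show 1539 ≤ n by omega)
  -- The fractional part of `27 * k / 50` is at most `0.98`, so that rounding up costs `0.98`.
  have hfloor : 27 * (n + 1) ≤ 50 * (27 * (n + 1) / 50) + 49 := by omega
  have hfloor' : 50 * (27 * (n + 1) / 50) ≤ 27 * (n + 1) := Nat.mul_div_le _ _
  have hle : edgeSetListSize (n + 1) ≤ 27 * (n + 1) / 50 := by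
    refine Nat.ceil_le.mpr ?_
    have h1 : (27 * (n + 1) : ℝ) ≤ 50 * ((27 * (n + 1) / 50 : ℕ) : ℝ) + 49 := by
      exact_mod_cast hfloor
    simp only [Nat.add_sub_cancel]
    push_cast at h1 ⊢
    rw [show (n : ℝ) + 1 - 1 = n by ring, show (n : ℝ) + 1 - 2 = n - 1 by ring]
    linarith
  have h2 : (50 : ℝ) * edgeSetListSize (n + 1) ≤ 27 * ((n + 1 : ℕ) : ℝ) := by
    exact_mod_cast (Nat.mul_le_mul_left 50 hle).trans hfloor'
  linarith

/-- The list size leaves room for the growth factor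
`(8 * (k - 1) * (k - 2) * f) ^ (1 / (k - 1))` per edge. -/
theorem exists_growth_edgeSetListSize {k : ℕ} (hk : 3 ≤ k) :
    ∃ β : ℝ, 0 < β ∧ β ≤ edgeSetListSize k ∧
      β + 2 * k * (totalPreorderCount (k - 1) / β ^ (k - 1)) * edgeSetListSize k ≤
        edgeSetListSize k := by
  have hkR : (3 : ℝ) ≤ k := by exact_mod_cast hk
  have hceil := Nat.le_ceil ((2 : ℝ) + ((k : ℝ) - 1) / ((k : ℝ) - 2) *
    (8 * ((k : ℝ) - 1) * ((k : ℝ) - 2) * (totalPreorderCount (k - 1) : ℝ)) ^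
      (1 / ((k : ℝ) - 1)))
  change _ ≤ (edgeSetListSize k : ℝ) at hceil
  have hf : (0 : ℝ) < totalPreorderCount (k - 1) := Nat.cast_pos.mpr (totalPreorderCount_pos _)
  set f : ℝ := (totalPreorderCount (k - 1) : ℝ)
  set R : ℝ := (edgeSetListSize k : ℝ)
  have h1 : (0 : ℝ) < k - 1 := by linarith
  have h2 : (0 : ℝ) < k - 2 := by linarith
  have hX : 0 < 8 * ((k : ℝ) - 1) * (k - 2) * f := by positivity
  have hpow : ((8 * ((k : ℝ) - 1) * (k - 2) * f) ^ (1 / ((k : ℝ) - 1))) ^ (k - 1) =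
      8 * ((k : ℝ) - 1) * (k - 2) * f := by
    have hcast : (k : ℝ) - 1 = ((k - 1 : ℕ) : ℝ) := by
      rw [Nat.cast_sub (by omega), Nat.cast_one]
    have := rpow_inv_natCast_pow hX.le (show k - 1 ≠ 0 by omega)
    rwa [← hcast, ← one_div] at this
  have hβ : 0 < (8 * ((k : ℝ) - 1) * (k - 2) * f) ^ (1 / ((k : ℝ) - 1)) := rpow_pos_of_pos hX _
  set β : ℝ := (8 * ((k : ℝ) - 1) * (k - 2) * f) ^ (1 / ((k : ℝ) - 1))
  have hR : ((k : ℝ) - 1) / (k - 2) * β ≤ R := by linarith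
  rw [div_mul_eq_mul_div, div_le_iff₀ h2] at hR
  have hR0 : 0 < R := by
    have : 0 < ((k : ℝ) - 1) / (k - 2) * β := by positivity
    linarith
  have hgoal : β + 2 * k * (f / β ^ (k - 1)) * R ≤ R := by
    rw [hpow]
    have h3 : 2 * (k : ℝ) * (f / (8 * (k - 1) * (k - 2) * f)) * R =
        k * R / (4 * (k - 1) * (k - 2)) := by
      field_simp
      ring
    rw [h3, ← le_sub_iff_add_le']
    rw [div_le_iff₀ (by positivity)]
    -- `k ≤ 4 * (k - 2)` is what remains after `β` is eliminated.
    nlinarith [mul_le_mul_of_nonneg_right hR (mul_pos (show (0 : ℝ) < 4 by norm_num) h2).le,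
      mul_nonneg hR0.le (show (0 : ℝ) ≤ 3 * k - 8 by linarith)]
  refine ⟨β, hβ, ?_, hgoal⟩
  have : 0 ≤ 2 * k * (f / β ^ (k - 1)) * R := by positivity
  linarith

end

theorem corollary4p1 (k : ℕ) (hk : 3 ≤ k) :
    (∀ (V : Type*) [Fintype V] (G : SimpleGraph V) [DecidableRel G.Adj] (α : Type*)
      (L : G.edgeSet → Finset α),
      G.IsRegularOfDegree k →
      (∀ e : G.edgeSet, edgeSetListSize k ≤ (L e).card) →
      ∃ μ : G.edgeSet → α, (∀ e : G.edgeSet, μ e ∈ L e) ∧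
        G.DistinguishesNeighborsBySets μ) ∧
    (1540 ≤ k → (edgeSetListSize k : ℝ) ≤ 0.54 * (k : ℝ)) := by
  refine ⟨?_, edgeSetListSize_le⟩
  intro V _ G _ α L hG hL
  choose L' hL' hcard using fun e => Finset.exists_subset_card_eq (hL e)
  obtain ⟨β, hβ, hβR, hgrow⟩ := exists_growth_edgeSetListSize hk
  obtain ⟨μ, hμ, hdist⟩ := SimpleGraph.exists_distinguishing_of_growth (by omega) hG L' hcard
    hβ hβR hgrow
  exact ⟨μ, fun e => hL' e (hμ e), hdist⟩
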